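/- Let $n\ge 4$ and let $A=\{a_1<a_2<\dots<a_m\}$ be a nonempty subset of $[n]=\{1,2,\dots,n\}$. The graph $QJ(n,A)$ is defined as follows. Its vertices are the subsets $u\subseteq[n]$ with $|u|\in A$. Two vertices $u,v$ with $|u|=|v|=a_i$ are adjacent if and only if $|u\cap v|=a_i-1$ (so level $i$ is a copy of the Johnson graph $J(n,a_i)$); a vertex $u$ with $|u|=a_i$ and a vertex $v$ with $|v|=a_{i+1}$ are adjacent if and only if $u\subseteq v$; there are no other edges. If $|V(QJ(n,A))|\ge 4$, then $QJ(n,A)$ is paired 2-coverable; that is, for any two disjoint two-element vertex sets $S=\{u,x\}$ and $T=\{v,y\}$ there are two vertex-disjoint paths in $QJ(n,A)$, one with endpoints $u,v$ and one with endpoints $x,y$, which together cover every vertex of $QJ(n,A)$. -/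

import Mathlib

/-- The condition that two vertices of a Johnson graph `J(n,k)` are adjacent: `u` and `v` are
subsets of an `n`-element set with the same number `k` of elements, and they have exactly `k - 1`
elements in common (written without subtraction). -/
def JohnsonAdj {n : ℕ} (u v : Finset (Fin n)) : Prop :=
  u.card = v.card ∧ (u ∩ v).card + 1 = u.card

/-- `a` and `b` are consecutive elements of `A`, in increasing order. -/
def ConsecutiveIn (A : Finset ℕ) (a b : ℕ) : Prop :=
  a ∈ A ∧ b ∈ A ∧ a < b ∧ ∀ c ∈ A, ¬ (a < c ∧ c < b)

/-- The vertices of `QJ(n,A)`: the disjoint union over `a ∈ A` of the `a`-subsets of an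
`n`-element set (the level of a vertex is determined by its number of elements). -/
abbrev QJVertex (n : ℕ) (A : Finset ℕ) : Type :=
  {s : Finset (Fin n) // s.card ∈ A}

/-- The graph `QJ(n,A)`: each level `a ∈ A` carries the Johnson graph `J(n,a)`, and a vertex `u`
of one level is joined to a vertex `v` of the next level whenever `u ⊆ v`. -/
def QJ (n : ℕ) (A : Finset ℕ) : SimpleGraph (QJVertex n A) where
  Adj u v :=
    JohnsonAdj u.1 v.1 ∨
      (ConsecutiveIn A u.1.card v.1.card ∧ u.1 ⊆ v.1) ∨
      (ConsecutiveIn A v.1.card u.1.card ∧ v.1 ⊆ u.1)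
  symm := ⟨by
    rintro u v (⟨h1, h2⟩ | h | h)
    · exact Or.inl ⟨h1.symm, by rw [Finset.inter_comm, h2, h1]⟩
    · exact Or.inr (Or.inr h)
    · exact Or.inr (Or.inl h)⟩
  loopless := ⟨by
    rintro u (⟨_, h⟩ | ⟨h, _⟩ | ⟨h, _⟩)
    · simp at h
    · exact lt_irrefl _ h.2.2.1
    · exact lt_irrefl _ h.2.2.1⟩

/-- A graph is paired 2-coverable if for any two disjoint two-element vertex sets `{u, x}` and
`{v, y}` there are vertex-disjoint paths, one from `u` to `v` and one from `x` to `y`, that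
together cover every vertex. -/
def PairedTwoCoverable {V : Type*} (G : SimpleGraph V) : Prop :=
  ∀ u x v y : V, u ≠ x → v ≠ y → Disjoint ({u, x} : Set V) {v, y} →
    ∃ (p : G.Walk u v) (q : G.Walk x y),
      p.IsPath ∧ q.IsPath ∧ p.support.Disjoint q.support ∧
        ∀ w : V, w ∈ p.support ∨ w ∈ q.support

/-! The graph is assembled from small pieces by one gluing principle, `MarkedCoverable.glue`. Let
two disjoint pieces be paired 2-coverable, with enough edges between them. If the four ends are
distributed over both pieces, cover each piece separately and link the parts by cross edges that
avoid the prescribed ends. If all ends lie in one piece, open an edge `ab` of one of the two paths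
and replace it by a detour: a cross edge from `a`, a spanning path of the other piece, and a cross
edge back to `b`. When levels are added upwards, only the current top level is joined to the next
one, so `ab` has to lie there. Hence the induction carries a stronger statement: one of the two
paths has an edge in a prescribed set, the mark.

The principle is used twice. A Johnson graph is split by whether a set contains a fixed point `e`,
down to complete graphs and the octahedron `J(4,2)` (`markedCoverable_slice`). Then the levels below
`n` are glued in increasing order, the mark moving to each new top level (`markedCoverable_levels`).
In both cases the cross edges come from counting sets between two given ones
(`exists_cross_matching`). If `n ∈ A`, the full set is finally inserted into a marked edge, as it is
adjacent to the whole preceding level (`MarkedCoverable.insert_apex`). -/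

/-- `u` and `v` are joined by a path of `G` whose set of vertices is `S`. -/
def Spans {V : Type*} (G : SimpleGraph V) (u v : V) (S : Set V) : Prop :=
  ∃ p : G.Walk u v, p.IsPath ∧ ∀ w, w ∈ p.support ↔ w ∈ S

/-- `u` and `v` are joined by a path of `G` whose set of vertices is `S` and which has an edge
with both ends in `X`. -/
def MarkedSpans {V : Type*} (G : SimpleGraph V) (X : Set V) (u v : V) (S : Set V) : Prop :=
  ∃ a b S₁ S₂, a ∈ X ∧ b ∈ X ∧ G.Adj a b ∧ Spans G u a S₁ ∧ Spans G b v S₂ ∧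
    Disjoint S₁ S₂ ∧ S₁ ∪ S₂ = S

/-- Disjoint paths from `u` to `v` and from `x` to `y` cover exactly the set `S`, and one of them
has an edge inside `X`. -/
def MarkedCover {V : Type*} (G : SimpleGraph V) (S X : Set V) (u v x y : V) : Prop :=
  ∃ S₁ S₂, Disjoint S₁ S₂ ∧ S₁ ∪ S₂ = S ∧
    ((MarkedSpans G X u v S₁ ∧ Spans G x y S₂) ∨ (Spans G u v S₁ ∧ MarkedSpans G X x y S₂))

/-- The subgraph of `G` on `S` is paired 2-coverable, by pairs of paths that have an edge
inside `X`. -/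
def MarkedCoverable {V : Type*} (G : SimpleGraph V) (S X : Set V) : Prop :=
  ∀ u v x y, u ∈ S → v ∈ S → x ∈ S → y ∈ S → u ≠ v → u ≠ x → u ≠ y → v ≠ x → v ≠ y → x ≠ y →
    MarkedCover G S X u v x y

/-! ### Paths with prescribed vertex sets, and gluing of coverable pieces -/

section Paths

variable {V : Type*} {G : SimpleGraph V} {S T X Y : Set V} {u v w x y a b : V}

namespace Spans

theorem single (u : V) : Spans G u u {u} := ⟨.nil, by simp, by simp⟩

theorem left_mem (h : Spans G u v S) : u ∈ S := by
  obtain ⟨p, -, hp⟩ := h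
  exact (hp u).1 p.start_mem_support

theorem symm (h : Spans G u v S) : Spans G v u S := by
  obtain ⟨p, h1, h2⟩ := h
  exact ⟨p.reverse, h1.reverse, by simpa using h2⟩

theorem right_mem (h : Spans G u v S) : v ∈ S := h.symm.left_mem

theorem cons (h : Spans G v w S) (huv : G.Adj u v) (hu : u ∉ S) : Spans G u w (insert u S) := by
  obtain ⟨p, h1, h2⟩ := h
  refine ⟨.cons huv p, ?_, ?_⟩
  · rw [SimpleGraph.Walk.cons_isPath_iff]
    exact ⟨h1, by rwa [h2]⟩
  · simp [h2]

theorem append (h : Spans G u a S) (hab : G.Adj a b) (h' : Spans G b v T) (hST : Disjoint S T) :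
    Spans G u v (S ∪ T) := by
  obtain ⟨p, h1, h2⟩ := h
  induction p generalizing S with
  | @nil c =>
    have : S = {c} := Set.ext fun w => by rw [← h2]; simp
    subst this
    exact h'.cons hab (by simpa using hST)
  | @cons c d e hcd p ih =>
    rw [SimpleGraph.Walk.cons_isPath_iff] at h1
    have hS : S = insert c {w | w ∈ p.support} := Set.ext fun w => by rw [← h2]; simp
    subst hS
    rw [Set.disjoint_insert_left] at hST
    have := (ih hab hST.2 h1.1 (by simp)).cons hcd (by simp [h1.2, hST.1])
    rwa [← Set.insert_union] at this

theorem marked (h : Spans G u v S) (huv : u ≠ v) (hX : S ⊆ X) : MarkedSpans G X u v S := by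
  obtain ⟨p, h1, h2⟩ := h
  cases p with
  | nil => exact absurd rfl huv
  | @cons _ d _ hcd p =>
    rw [SimpleGraph.Walk.cons_isPath_iff] at h1
    have hS : S = insert u {w | w ∈ p.support} := Set.ext fun w => by rw [← h2]; simp
    refine ⟨u, d, {u}, {w | w ∈ p.support}, hX ?_, hX ?_, hcd, single u,
      ⟨p, h1.1, fun _ => Iff.rfl⟩, by simpa using h1.2, by rw [hS, Set.singleton_union]⟩
    · simp [hS]
    · simp [hS]

end Spans

namespace MarkedSpans

theorem spans (h : MarkedSpans G X u v S) : Spans G u v S := by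
  obtain ⟨a, b, S₁, S₂, -, -, hab, h1, h2, hd, rfl⟩ := h
  exact h1.append hab h2 hd

theorem mono (h : MarkedSpans G X u v S) (hXY : X ⊆ Y) : MarkedSpans G Y u v S := by
  obtain ⟨a, b, S₁, S₂, ha, hb, h⟩ := h
  exact ⟨a, b, S₁, S₂, hXY ha, hXY hb, h⟩

theorem symm (h : MarkedSpans G X u v S) : MarkedSpans G X v u S := by
  obtain ⟨a, b, S₁, S₂, ha, hb, hab, h1, h2, hd, rfl⟩ := h
  exact ⟨b, a, S₂, S₁, hb, ha, hab.symm, h2.symm, h1.symm, hd.symm, Set.union_comm _ _⟩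

theorem prepend (h' : MarkedSpans G X b v T) (h : Spans G u a S) (hab : G.Adj a b)
    (hST : Disjoint S T) : MarkedSpans G X u v (S ∪ T) := by
  obtain ⟨c, d, S₁, S₂, hc, hd, hcd, h1, h2, hdis, rfl⟩ := h'
  rw [Set.disjoint_union_right] at hST
  exact ⟨c, d, S ∪ S₁, S₂, hc, hd, hcd, h.append hab h1 hST.1, h2,
    Set.disjoint_union_left.2 ⟨hST.2, hdis⟩, Set.union_assoc _ _ _⟩

theorem append (h : MarkedSpans G X u a S) (hab : G.Adj a b) (h' : Spans G b v T)
    (hST : Disjoint S T) : MarkedSpans G X u v (S ∪ T) := by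
  rw [Set.union_comm]
  exact (h.symm.prepend h'.symm hab.symm hST.symm).symm

end MarkedSpans

namespace MarkedCover

theorem swap (h : MarkedCover G S X u v x y) : MarkedCover G S X x y u v := by
  obtain ⟨S₁, S₂, hd, hS, h⟩ := h
  exact ⟨S₂, S₁, hd.symm, by rwa [Set.union_comm], by tauto⟩

theorem reverse_right (h : MarkedCover G S X u v x y) : MarkedCover G S X u v y x := by
  obtain ⟨S₁, S₂, hd, hS, h | h⟩ := h
  · exact ⟨S₁, S₂, hd, hS, Or.inl ⟨h.1, h.2.symm⟩⟩
  · exact ⟨S₁, S₂, hd, hS, Or.inr ⟨h.1, h.2.symm⟩⟩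

theorem reverse_left (h : MarkedCover G S X u v x y) : MarkedCover G S X v u x y :=
  h.swap.reverse_right.swap

theorem mono (h : MarkedCover G S X u v x y) (hXY : X ⊆ Y) : MarkedCover G S Y u v x y := by
  obtain ⟨S₁, S₂, hd, hS, h | h⟩ := h
  · exact ⟨S₁, S₂, hd, hS, Or.inl ⟨h.1.mono hXY, h.2⟩⟩
  · exact ⟨S₁, S₂, hd, hS, Or.inr ⟨h.1, h.2.mono hXY⟩⟩

theorem spans (h : MarkedCover G S X u v x y) :
    ∃ S₁ S₂, Disjoint S₁ S₂ ∧ S₁ ∪ S₂ = S ∧ Spans G u v S₁ ∧ Spans G x y S₂ := by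
  obtain ⟨S₁, S₂, hd, hS, h | h⟩ := h
  · exact ⟨S₁, S₂, hd, hS, h.1.spans, h.2⟩
  · exact ⟨S₁, S₂, hd, hS, h.1, h.2.spans⟩

end MarkedCover

theorem MarkedCoverable.mono (h : MarkedCoverable G S X) (hXY : X ⊆ Y) : MarkedCoverable G S Y :=
  fun u v x y hu hv hx hy h1 h2 h3 h4 h5 h6 =>
    (h u v x y hu hv hx hy h1 h2 h3 h4 h5 h6).mono hXY

/-- A paired 2-coverable set with two vertices besides `s` and `t` has a spanning path from `s`
to `t`. -/
theorem MarkedCoverable.spans (h : MarkedCoverable G S X) {s t p q : V} (hs : s ∈ S) (ht : t ∈ S)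
    (hp : p ∈ S) (hq : q ∈ S) (hst : s ≠ t) (hpq : p ≠ q) (hsp : s ≠ p) (hsq : s ≠ q)
    (htp : t ≠ p) (htq : t ≠ q) : Spans G s t S := by
  -- This first cover only serves to find an edge `ab` avoiding `s` and `t`. A second cover, with
  -- paths from `s` to `a` and from `t` to `b`, is then joined along `ab`.
  obtain ⟨S₁, S₂, hd, hS, h1, h2⟩ :=
    (h s t p q hs ht hp hq hst hsp hsq htp htq hpq).spans
  obtain ⟨a, b, T₁, T₂, ha, hb, hab, hpa, hbq, hd', hS'⟩ := h2.marked hpq subset_rfl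
  have hs1 := h1.left_mem
  have ht1 := h1.right_mem
  have hne : ∀ c ∈ S₁, ∀ d ∈ S₂, c ≠ d := fun c hc d hd' hcd =>
    Set.disjoint_left.1 hd hc (hcd ▸ hd')
  have hsub : S₂ ⊆ S := hS ▸ Set.subset_union_right
  obtain ⟨R₁, R₂, hR, hRS, k1, k2⟩ := (h s a t b hs (hsub ha) ht (hsub hb) (hne s hs1 a ha) hst
    (hne s hs1 b hb) (hne t ht1 a ha).symm hab.ne (hne t ht1 b hb)).spans
  exact hRS ▸ k1.append hab k2.symm hR

/-- Paired 2-coverability of the union of two disjoint sets with sufficiently many edges between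
them. -/
theorem MarkedCoverable.glue {V₁ V₂ : Set V} (hd : Disjoint V₁ V₂) (hX : X ⊆ V₁)
    (h₁ : MarkedCoverable G V₁ X) (h₂ : MarkedCoverable G V₂ V₂)
    (hM : ∀ u x v y : V, ∃ z ∈ X, ∃ w ∈ X, ∃ z' ∈ V₂, ∃ w' ∈ V₂, z ≠ w ∧ z' ≠ w' ∧
      G.Adj z z' ∧ G.Adj w w' ∧ z ≠ u ∧ z ≠ x ∧ w ≠ u ∧ w ≠ x ∧
      z' ≠ v ∧ z' ≠ y ∧ w' ≠ v ∧ w' ≠ y)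
    (hup : ∀ a ∈ X, ∀ b ∈ X, a ≠ b → ∃ a' ∈ V₂, ∃ b' ∈ V₂, a' ≠ b' ∧ G.Adj a a' ∧ G.Adj b b')
    (hdown : ∀ a ∈ V₂, ∀ b ∈ V₂, a ≠ b →
      ∃ a' ∈ V₁, ∃ b' ∈ V₁, a' ≠ b' ∧ G.Adj a a' ∧ G.Adj b b') :
    MarkedCoverable G (V₁ ∪ V₂) V₂ := by
  have hc₁ : ∀ s ∈ V₁, ∀ t ∈ V₁, s ≠ t → Spans G s t V₁ := by
    intro s hs t ht hst
    obtain ⟨z, hz, w, hw, -, -, -, -, hzw, -, -, -, h1, h2, h3, h4, -⟩ := hM s t s t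
    exact h₁.spans hs ht (hX hz) (hX hw) hst hzw h1.symm h3.symm h2.symm h4.symm
  have hc₂ : ∀ s ∈ V₂, ∀ t ∈ V₂, s ≠ t → MarkedSpans G V₂ s t V₂ := by
    intro s hs t ht hst
    obtain ⟨-, -, -, -, z, hz, w, hw, -, hzw, -, -, -, -, -, -, h1, h2, h3, h4⟩ := hM s t s t
    exact (h₂.spans hs ht hz hw hst hzw h1.symm h3.symm h2.symm h4.symm).marked hst subset_rfl
  have hne : ∀ a ∈ V₁, ∀ b ∈ V₂, a ≠ b := fun a ha b hb hab =>
    Set.disjoint_left.1 hd ha (hab ▸ hb)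
  -- all four ends in `V₁`, with the marked edge on the first path
  have detour₁ : ∀ u v x y S₁ S₂, Disjoint S₁ S₂ → S₁ ∪ S₂ = V₁ → MarkedSpans G X u v S₁ →
      Spans G x y S₂ → MarkedCover G (V₁ ∪ V₂) V₂ u v x y := by
    rintro u v x y S₁ S₂ hS rfl ⟨a, b, T₁, T₂, ha, hb, hab, hu, hv, hT, rfl⟩ hxy
    obtain ⟨a', ha', b', hb', hne', haa, hbb⟩ := hup a ha b hb hab.ne
    simp only [Set.disjoint_union_left] at hd hS
    refine ⟨T₁ ∪ (V₂ ∪ T₂), S₂, ?_, ?_, Or.inl ⟨?_, hxy⟩⟩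
    · simp only [Set.disjoint_union_left]
      exact ⟨hS.1, hd.2.symm, hS.2⟩
    · ext; simp only [Set.mem_union]; tauto
    · refine ((hc₂ a' ha' b' hb' hne').append hbb.symm hv hd.1.2.symm).prepend hu haa ?_
      simp only [Set.disjoint_union_right]
      exact ⟨hd.1.1, hT⟩
  have all₁ : ∀ u v x y, u ∈ V₁ → v ∈ V₁ → x ∈ V₁ → y ∈ V₁ → u ≠ v → u ≠ x → u ≠ y → v ≠ x →
      v ≠ y → x ≠ y → MarkedCover G (V₁ ∪ V₂) V₂ u v x y := by
    intro u v x y hu hv hx hy e1 e2 e3 e4 e5 e6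
    obtain ⟨S₁, S₂, hS, hSV, h | h⟩ := h₁ u v x y hu hv hx hy e1 e2 e3 e4 e5 e6
    · exact detour₁ u v x y S₁ S₂ hS hSV h.1 h.2
    · exact (detour₁ x y u v S₂ S₁ hS.symm (by rwa [Set.union_comm]) h.2 h.1).swap
  -- The detour through `V₁` may use any edge of the first path. The mark is kept by the second
  -- path, which stays inside `V₂`.
  have all₂ : ∀ u v x y, u ∈ V₂ → v ∈ V₂ → x ∈ V₂ → y ∈ V₂ → u ≠ v → u ≠ x → u ≠ y → v ≠ x →
      v ≠ y → x ≠ y → MarkedCover G (V₁ ∪ V₂) V₂ u v x y := by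
    intro u v x y hu hv hx hy e1 e2 e3 e4 e5 e6
    obtain ⟨S₁, S₂, hS, hSV, h, h'⟩ := (h₂ u v x y hu hv hx hy e1 e2 e3 e4 e5 e6).spans
    subst hSV
    obtain ⟨a, b, T₁, T₂, ha, hb, hab, hua, hbv, hT, rfl⟩ := h.marked e1 subset_rfl
    obtain ⟨a', ha', b', hb', hne', haa, hbb⟩ := hdown a (Or.inl ha) b (Or.inl hb) hab.ne
    simp only [Set.disjoint_union_right, Set.disjoint_union_left] at hd hS
    refine ⟨T₁ ∪ (V₁ ∪ T₂), S₂, ?_, ?_, Or.inr ⟨?_, h'.marked e6 Set.subset_union_right⟩⟩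
    · simp only [Set.disjoint_union_left]
      exact ⟨hS.1, hd.2, hS.2⟩
    · ext; simp only [Set.mem_union]; tauto
    · refine hua.append haa ((hc₁ a' ha' b' hb' hne').append hbb.symm hbv hd.1.2) ?_
      simp only [Set.disjoint_union_right]
      exact ⟨hd.1.1.symm, hT⟩
  have three₁ : ∀ u v x y, u ∈ V₁ → v ∈ V₁ → x ∈ V₁ → y ∈ V₂ → u ≠ v → u ≠ x → v ≠ x →
      MarkedCover G (V₁ ∪ V₂) V₂ u v x y := by
    intro u v x y hu hv hx hy e1 e2 e4
    -- `hM` avoids only two vertices on this side. Its two cross edges have distinct ends, so one of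
    -- them also avoids `v`.
    obtain ⟨z, hz, z', hz', hadj, n1, n2, n3, n4⟩ : ∃ z ∈ X, ∃ z' ∈ V₂, G.Adj z z' ∧ z ≠ u ∧
        z ≠ x ∧ z ≠ v ∧ z' ≠ y := by
      obtain ⟨z, hz, w, hw, z', hz', w', hw', hzw, -, hz1, hw1, f1, f2, f3, f4, f5, -, f7, -⟩ :=
        hM u x y y
      by_cases hzv : z = v
      · exact ⟨w, hw, w', hw', hw1, f3, f4, fun h => hzw (hzv.trans h.symm), f7⟩
      · exact ⟨z, hz, z', hz', hz1, f1, f2, hzv, f5⟩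
    obtain ⟨S₁, S₂, hS, hSV, h, h'⟩ :=
      (h₁ u v x z hu hv hx (hX hz) e1 e2 n1.symm e4 n3.symm n2.symm).spans
    subst hSV
    rw [Set.disjoint_union_left] at hd
    exact ⟨S₁, S₂ ∪ V₂, Set.disjoint_union_right.2 ⟨hS, hd.1⟩, (Set.union_assoc _ _ _).symm,
      Or.inr ⟨h, (hc₂ z' hz' y hy n4).prepend h' hadj hd.2⟩⟩
  have three₂ : ∀ u v x y, u ∈ V₂ → v ∈ V₂ → x ∈ V₂ → y ∈ V₁ → u ≠ v → u ≠ x → v ≠ x →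
      MarkedCover G (V₁ ∪ V₂) V₂ u v x y := by
    intro u v x y hu hv hx hy e1 e2 e4
    obtain ⟨z, hz, z', hz', hadj, n1, n2, n3, n4⟩ : ∃ z ∈ V₂, ∃ z' ∈ V₁, G.Adj z z' ∧ z ≠ u ∧
        z ≠ x ∧ z ≠ v ∧ z' ≠ y := by
      obtain ⟨z, hz, w, hw, z', hz', w', hw', -, hzw, hz1, hw1, f1, -, f3, -, f5, f6, f7, f8⟩ :=
        hM y y u x
      by_cases hzv : z' = v
      · exact ⟨w', hw', w, hX hw, hw1.symm, f7, f8, fun h => hzw (hzv.trans h.symm), f3⟩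
      · exact ⟨z', hz', z, hX hz, hz1.symm, f5, f6, hzv, f1⟩
    obtain ⟨S₁, S₂, hS, hSV, h⟩ :=
      h₂ u v x z hu hv hx hz e1 e2 n1.symm e4 n3.symm n2.symm
    have hd' := hd
    rw [← hSV, Set.disjoint_union_right] at hd'
    refine ⟨S₁, S₂ ∪ V₁, Set.disjoint_union_right.2 ⟨hS, hd'.1.symm⟩, ?_, ?_⟩
    · rw [← Set.union_assoc, hSV, Set.union_comm]
    · have hzy := hc₁ z' hz' y hy n4
      exact h.imp (fun h => ⟨h.1, h.2.append hadj hzy hd'.2.symm⟩)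
        fun h => ⟨h.1, h.2.append hadj hzy hd'.2.symm⟩
  have parallel : ∀ u v x y, u ∈ V₁ → v ∈ V₁ → x ∈ V₂ → y ∈ V₂ → u ≠ v → x ≠ y →
      MarkedCover G (V₁ ∪ V₂) V₂ u v x y := fun u v x y hu hv hx hy e1 e6 =>
    ⟨V₁, V₂, hd, rfl, Or.inr ⟨hc₁ u hu v hv e1, hc₂ x hx y hy e6⟩⟩
  have crossing : ∀ u v x y, u ∈ V₁ → v ∈ V₂ → x ∈ V₁ → y ∈ V₂ → u ≠ x → v ≠ y →
      MarkedCover G (V₁ ∪ V₂) V₂ u v x y := by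
    intro u v x y hu hv hx hy e1 e6
    obtain ⟨z, hz, w, hw, z', hz', w', hw', hzw, hzw', hz1, hw1, f1, f2, f3, f4, f5, f6, f7, f8⟩ :=
      hM u x v y
    obtain ⟨S₁, S₂, hS, hSV, h, h'⟩ := (h₁ u z x w hu (hX hz) hx (hX hw) f1.symm e1 f3.symm f2
      hzw f4.symm).spans
    obtain ⟨T₁, T₂, hT, hTV, k⟩ := h₂ z' v w' y hz' hv hw' hy f5 hzw' f6 f7.symm e6 f8
    have hd' := hd
    rw [← hSV, ← hTV] at hd'
    simp only [Set.disjoint_union_right, Set.disjoint_union_left] at hd'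
    refine ⟨S₁ ∪ T₁, S₂ ∪ T₂, ?_, ?_, ?_⟩
    · simp only [Set.disjoint_union_right, Set.disjoint_union_left]
      exact ⟨⟨hS, hd'.1.2.symm⟩, hd'.2.1, hT⟩
    · rw [← hSV, ← hTV, Set.union_union_union_comm]
    · exact k.imp (fun k => ⟨k.1.prepend h hz1 hd'.1.1, h'.append hw1 k.2 hd'.2.2⟩)
        fun k => ⟨h.append hz1 k.1 hd'.1.1, k.2.prepend h' hw1 hd'.2.2⟩
  intro u v x y hu hv hx hy e1 e2 e3 e4 e5 e6
  rcases hu with hu | hu <;> rcases hv with hv | hv <;> rcases hx with hx | hx <;>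
    rcases hy with hy | hy
  · exact all₁ u v x y hu hv hx hy e1 e2 e3 e4 e5 e6
  · exact three₁ u v x y hu hv hx hy e1 e2 e4
  · exact (three₁ u v y x hu hv hy hx e1 e3 e5).reverse_right
  · exact parallel u v x y hu hv hx hy e1 e6
  · exact (three₁ x y u v hx hy hu hv e6 e2.symm e3.symm).swap
  · exact crossing u v x y hu hv hx hy e2 e5
  · exact (crossing u v y x hu hv hy hx e3 e4).reverse_right
  · exact (three₂ x y v u hx hy hv hu e6 e4.symm e5.symm).reverse_right.swap
  · exact (three₁ x y v u hx hy hv hu e6 e4.symm e5.symm).reverse_right.swap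
  · exact (crossing v u x y hv hu hx hy e4 e3).reverse_left
  · exact (crossing v u y x hv hu hy hx e5 e2).reverse_left.reverse_right
  · exact (three₂ x y u v hx hy hu hv e6 e2.symm e3.symm).swap
  · exact (parallel x y u v hx hy hu hv e6 e1).swap
  · exact (three₂ u v y x hu hv hy hx e1 e3 e5).reverse_right
  · exact three₂ u v x y hu hv hx hy e1 e2 e4
  · exact all₂ u v x y hu hv hx hy e1 e2 e3 e4 e5 e6

/-- Paired 2-coverability is preserved by adding a vertex that is adjacent to all of `X`. -/
theorem MarkedCoverable.insert_apex (h : MarkedCoverable G S X) (ha : a ∉ S) (hX : X ⊆ S)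
    (hadj : ∀ z ∈ X, G.Adj z a)
    (hcard : ∀ u v x : V, ∃ z ∈ X, z ≠ u ∧ z ≠ v ∧ z ≠ x) :
    MarkedCoverable G (insert a S) Set.univ := by
  -- The new vertex subdivides the marked edge.
  have detour : ∀ u v x y S₁ S₂, Disjoint S₁ S₂ → S₁ ∪ S₂ = S → u ≠ v → MarkedSpans G X u v S₁ →
      Spans G x y S₂ → MarkedCover G (insert a S) Set.univ u v x y := by
    rintro u v x y S₁ S₂ hS rfl huv ⟨b, c, T₁, T₂, hb, hc, -, hu, hv, hT, rfl⟩ hxy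
    simp only [Set.mem_union, not_or] at ha
    simp only [Set.disjoint_union_left] at hS
    refine ⟨T₁ ∪ insert a T₂, S₂, ?_, ?_,
      Or.inl ⟨(hu.append (hadj b hb) (hv.cons (hadj c hc).symm ha.1.2) ?_).marked huv
        (Set.subset_univ _), hxy⟩⟩
    · rw [Set.disjoint_union_left, Set.disjoint_insert_left]
      exact ⟨hS.1, ha.2, hS.2⟩
    · ext; simp only [Set.mem_union, Set.mem_insert_iff]; tauto
    · rw [Set.disjoint_insert_right]
      exact ⟨ha.1.1, hT⟩
  have last : ∀ u v x, u ∈ S → v ∈ S → x ∈ S → u ≠ v → u ≠ x → v ≠ x →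
      MarkedCover G (insert a S) Set.univ u v x a := by
    intro u v x hu hv hx e1 e2 e4
    obtain ⟨z, hz, n1, n2, n3⟩ := hcard u v x
    obtain ⟨S₁, S₂, hS, hSV, k, k'⟩ :=
      (h u v x z hu hv hx (hX hz) e1 e2 n1.symm e4 n2.symm n3.symm).spans
    subst hSV
    simp only [Set.mem_union, not_or] at ha
    refine ⟨S₁, insert a S₂, ?_, Set.union_insert, Or.inl ⟨k.marked e1 (Set.subset_univ _),
      (k'.symm.cons (hadj z hz).symm ha.2).symm⟩⟩
    rw [Set.disjoint_insert_right]
    exact ⟨ha.1, hS⟩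
  intro u v x y hu hv hx hy e1 e2 e3 e4 e5 e6
  rw [Set.mem_insert_iff] at hu hv hx hy
  by_cases hya : y = a
  · subst hya
    exact last u v x (hu.resolve_left e3) (hv.resolve_left e5) (hx.resolve_left e6) e1 e2 e4
  by_cases hxa : x = a
  · subst hxa
    exact (last u v y (hu.resolve_left e2) (hv.resolve_left e4) (hy.resolve_left hya)
      e1 e3 e5).reverse_right
  replace hx := hx.resolve_left hxa
  replace hy := hy.resolve_left hya
  by_cases hva : v = a
  · subst hva
    exact (last x y u hx hy (hu.resolve_left e1) e6 e2.symm e3.symm).swap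
  replace hv := hv.resolve_left hva
  by_cases hua : u = a
  · subst hua
    exact (last x y v hx hy hv e6 e4.symm e5.symm).reverse_right.swap
  replace hu := hu.resolve_left hua
  obtain ⟨S₁, S₂, hS, hSV, k | k⟩ := h u v x y hu hv hx hy e1 e2 e3 e4 e5 e6
  · exact detour u v x y S₁ S₂ hS hSV e1 k.1 k.2
  · exact (detour x y u v S₂ S₁ hS.symm (by rwa [Set.union_comm]) e6 k.2 k.1).swap

/-- With the whole piece as mark there is nothing to arrange: a path with distinct ends has an edge.
-/
theorem MarkedCoverable.of_spans
    (h : ∀ u v x y, u ∈ S → v ∈ S → x ∈ S → y ∈ S → u ≠ v → u ≠ x → u ≠ y → v ≠ x → v ≠ y →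
      x ≠ y → ∃ S₁ S₂, Disjoint S₁ S₂ ∧ S₁ ∪ S₂ = S ∧ Spans G u v S₁ ∧ Spans G x y S₂) :
    MarkedCoverable G S S := by
  intro u v x y hu hv hx hy e1 e2 e3 e4 e5 e6
  obtain ⟨S₁, S₂, hS, hSV, k, k'⟩ := h u v x y hu hv hx hy e1 e2 e3 e4 e5 e6
  exact ⟨S₁, S₂, hS, hSV, Or.inl ⟨k.marked e1 (hSV ▸ Set.subset_union_left), k'⟩⟩

/-! ### Base cases: complete graphs and the octahedron -/

theorem Spans.of_clique {S : Finset V} (hS : ∀ a ∈ S, ∀ b ∈ S, a ≠ b → G.Adj a b) {u v : V}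
    (hu : u ∈ S) (hv : v ∈ S) (huv : u ≠ v) : Spans G u v (S : Set V) := by
  classical
  induction S using Finset.strongInduction generalizing u with
  | H S ih =>
    by_cases h : ∃ w ∈ S, w ≠ u ∧ w ≠ v
    · obtain ⟨w, hw, hwu, hwv⟩ := h
      have := (ih (S.erase u) (Finset.erase_ssubset hu)
        (fun a ha b hb => hS a (Finset.mem_of_mem_erase ha) b (Finset.mem_of_mem_erase hb))
        (Finset.mem_erase.2 ⟨hwu, hw⟩) (Finset.mem_erase.2 ⟨huv.symm, hv⟩) hwv).cons
        (hS u hu w hw hwu.symm) (by simp)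
      rwa [← Finset.coe_insert, Finset.insert_erase hu] at this
    · push Not at h
      have hSuv : (S : Set V) = insert u {v} := by
        ext w
        simp only [Finset.mem_coe, Set.mem_insert_iff, Set.mem_singleton_iff]
        constructor
        · intro hw
          by_cases hwu : w = u
          · exact Or.inl hwu
          · exact Or.inr (h w hw hwu)
        · rintro (rfl | rfl) <;> assumption
      rw [hSuv]
      exact (single v).cons (hS u hu v hv huv) (by simpa using huv)

theorem MarkedCoverable.of_clique {S : Finset V} (hS : ∀ a ∈ S, ∀ b ∈ S, a ≠ b → G.Adj a b) :
    MarkedCoverable G (S : Set V) (S : Set V) := by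
  classical
  refine of_spans fun u v x y hu hv hx hy e1 e2 e3 e4 e5 e6 => ?_
  refine ⟨({u, v} : Finset V), (S \ {u, v} : Finset V), ?_, ?_, ?_, ?_⟩
  · rw [Finset.disjoint_coe]
    exact Finset.disjoint_sdiff
  · rw [← Finset.coe_union, Finset.union_sdiff_of_subset]
    simp [Finset.insert_subset_iff, Finset.mem_coe.1 hu, Finset.mem_coe.1 hv]
  · rw [Finset.coe_pair]
    exact (Spans.single v).cons (hS u hu v hv e1) (by simpa using e1)
  · refine Spans.of_clique (fun a ha b hb => hS a (Finset.mem_sdiff.1 ha).1 b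
      (Finset.mem_sdiff.1 hb).1) ?_ ?_ e6
    · simp [Finset.mem_coe.1 hx, e2.symm, e4.symm]
    · simp [Finset.mem_coe.1 hy, e3.symm, e5.symm]

/-- The octahedron: six vertices, each of which is adjacent to all but at most one of the
others. -/
theorem MarkedCoverable.of_octahedron {S : Finset V} (hcard : S.card = 6)
    (hS : ∀ a ∈ S, ∀ b ∈ S, ∀ c ∈ S, a ≠ b → a ≠ c → b ≠ c → G.Adj a b ∨ G.Adj a c) :
    MarkedCoverable G (S : Set V) (S : Set V) := by
  classical
  refine of_spans fun u v x y hu hv hx hy e1 e2 e3 e4 e5 e6 => ?_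
  rw [Finset.mem_coe] at hu hv hx hy
  have hsub : ({u, v, x, y} : Finset V) ⊆ S := by
    simp [Finset.insert_subset_iff, hu, hv, hx, hy]
  have hc4 : ({u, v, x, y} : Finset V).card = 4 := by
    simp [e1, e2, e3, e4, e5, e6]
  have h2 : (S \ {u, v, x, y}).card = 2 := by
    rw [Finset.card_sdiff_of_subset hsub, hcard, hc4]
  obtain ⟨p, q, hpq, hpqS⟩ := Finset.card_eq_two.1 h2
  have hSS : S = {u, v, x, y, p, q} := by
    rw [← Finset.union_sdiff_of_subset hsub, hpqS]
    ext; simp; tauto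
  have hp : p ∈ S \ {u, v, x, y} := by simp [hpqS]
  have hq : q ∈ S \ {u, v, x, y} := by simp [hpqS]
  simp only [Finset.mem_sdiff, Finset.mem_insert, Finset.mem_singleton, not_or] at hp hq
  obtain ⟨hp, p1, p2, p3, p4⟩ := hp
  obtain ⟨hq, q1, q2, q3, q4⟩ := hq
  have two : ∀ a b, a ≠ b → G.Adj a b → Spans G a b {a, b} := fun a b hab h =>
    (Spans.single b).cons h (by simpa using hab)
  have three : ∀ a b c, a ≠ b → a ≠ c → b ≠ c → G.Adj a b → G.Adj b c → Spans G a c {a, b, c} :=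
    fun a b c hab hac hbc h h' => (two b c hbc h').cons h (by simp [hab, hac])
  have four : ∀ a b c d, a ≠ b → a ≠ c → a ≠ d → b ≠ c → b ≠ d → c ≠ d → G.Adj a b → G.Adj b c →
      G.Adj c d → Spans G a d {a, b, c, d} :=
    fun a b c d h1 h2 h3 h4 h5 h6 h h' h'' =>
      (three b c d h4 h5 h6 h' h'').cons h (by simp [h1, h2, h3])
  -- If `p` and `q` can serve as middle vertices of the two paths in one of the two ways, done.
  -- Otherwise they are adjacent and their non-neighbours are the two ends of the same path; those
  -- ends are then adjacent to each other, and the other path runs through both `p` and `q`.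
  have key : (G.Adj u p ∧ G.Adj p v ∧ G.Adj x q ∧ G.Adj q y) ∨
      (G.Adj u q ∧ G.Adj q v ∧ G.Adj x p ∧ G.Adj p y) ∨
      (G.Adj u v ∧ G.Adj x p ∧ G.Adj p q ∧ G.Adj q y) ∨
      (G.Adj x y ∧ G.Adj u p ∧ G.Adj p q ∧ G.Adj q v) := by
    have hs : ∀ a b, G.Adj a b ↔ G.Adj b a := fun a b => G.adj_comm a b
    have a1 := hS p hp u hu v hv p1 p2 e1
    have a2 := hS p hp u hu x hx p1 p3 e2
    have a3 := hS p hp u hu y hy p1 p4 e3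
    have a4 := hS p hp u hu q hq p1 hpq (Ne.symm q1)
    have a5 := hS p hp v hv x hx p2 p3 e4
    have a6 := hS p hp v hv y hy p2 p4 e5
    have a7 := hS p hp v hv q hq p2 hpq (Ne.symm q2)
    have a8 := hS p hp x hx y hy p3 p4 e6
    have a9 := hS p hp x hx q hq p3 hpq (Ne.symm q3)
    have a10 := hS p hp y hy q hq p4 hpq (Ne.symm q4)
    have b1 := hS q hq u hu v hv q1 q2 e1
    have b2 := hS q hq u hu x hx q1 q3 e2
    have b3 := hS q hq u hu y hy q1 q4 e3
    have b5 := hS q hq v hv x hx q2 q3 e4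
    have b6 := hS q hq v hv y hy q2 q4 e5
    have b8 := hS q hq x hx y hy q3 q4 e6
    have c1 := hS u hu v hv p hp e1 (Ne.symm p1) (Ne.symm p2)
    have c2 := hS u hu v hv q hq e1 (Ne.symm q1) (Ne.symm q2)
    have c3 := hS x hx y hy p hp e6 (Ne.symm p3) (Ne.symm p4)
    have c4 := hS x hx y hy q hq e6 (Ne.symm q3) (Ne.symm q4)
    have d1 := hS u hu p hp q hq (Ne.symm p1) (Ne.symm q1) hpq
    have d2 := hS v hv p hp q hq (Ne.symm p2) (Ne.symm q2) hpq
    have d3 := hS x hx p hp q hq (Ne.symm p3) (Ne.symm q3) hpq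
    have d4 := hS y hy p hp q hq (Ne.symm p4) (Ne.symm q4) hpq
    rw [hs u p, hs u q] at d1
    rw [hs v p, hs v q] at d2
    rw [hs x p, hs x q] at d3
    rw [hs y p, hs y q] at d4
    rw [hs u p, hs x q, hs x p, hs u q]
    rw [hs u p] at c1
    rw [hs u q] at c2
    rw [hs x p] at c3
    rw [hs x q] at c4
    clear hs hS hSS two three four
    generalize G.Adj p u = A1 at *
    generalize G.Adj p v = A2 at *
    generalize G.Adj p x = A3 at *
    generalize G.Adj p y = A4 at *
    generalize G.Adj q u = B1 at *
    generalize G.Adj q v = B2 at *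
    generalize G.Adj q x = B3 at *
    generalize G.Adj q y = B4 at *
    clear hu hv hx hy hsub hc4 h2 hpqS hp hq hcard
    grind
  rcases key with ⟨k1, k2, k3, k4⟩ | ⟨k1, k2, k3, k4⟩ | ⟨k1, k2, k3, k4⟩ | ⟨k1, k2, k3, k4⟩
  · exact ⟨{u, p, v}, {x, q, y}, by simp [*, Ne.symm],
      by rw [hSS]; push_cast; clear * -; grind,
      three _ _ _ (by grind) (by grind) (by grind) k1 k2,
      three _ _ _ (by grind) (by grind) (by grind) k3 k4⟩
  · exact ⟨{u, q, v}, {x, p, y}, by simp [*, Ne.symm],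
      by rw [hSS]; push_cast; clear * -; grind,
      three _ _ _ (by grind) (by grind) (by grind) k1 k2,
      three _ _ _ (by grind) (by grind) (by grind) k3 k4⟩
  · exact ⟨{u, v}, {x, p, q, y}, by simp [*, Ne.symm],
      by rw [hSS]; push_cast; clear * -; grind,
      two _ _ e1 k1,
      four _ _ _ _ (by grind) (by grind) (by grind) (by grind) (by grind) (by grind) k2 k3 k4⟩
  · exact ⟨{u, p, q, v}, {x, y}, by simp [*, Ne.symm],
      by rw [hSS]; push_cast; clear * -; grind,
      four _ _ _ _ (by grind) (by grind) (by grind) (by grind) (by grind) (by grind) k2 k3 k4,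
      two _ _ e6 k1⟩

end Paths

/-! ### Counting sets of given size in an interval -/

section Slices

/-- The `k`-element sets between `C` and `D`. -/
def slice {α : Type*} [DecidableEq α] (C D : Finset α) (k : ℕ) : Finset (Finset α) :=
  {s ∈ Finset.Icc C D | s.card = k}

variable {α : Type*} [DecidableEq α] {C D s t : Finset α} {a b k : ℕ}

theorem mem_slice : s ∈ slice C D k ↔ C ⊆ s ∧ s ⊆ D ∧ s.card = k := by
  simp [slice, and_assoc]

theorem card_slice (hCD : C ⊆ D) (hk : C.card ≤ k) :
    (slice C D k).card = (D.card - C.card).choose (k - C.card) := by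
  rw [← Finset.card_sdiff_of_subset hCD, ← Finset.card_powersetCard]
  symm
  refine Finset.card_bij (fun s _ => C ∪ s) ?_ ?_ ?_
  · intro s hs
    rw [Finset.mem_powersetCard, Finset.subset_sdiff] at hs
    rw [mem_slice, Finset.card_union_of_disjoint hs.1.2.symm]
    exact ⟨Finset.subset_union_left, Finset.union_subset hCD hs.1.1, by omega⟩
  · intro s hs t ht hst
    rw [Finset.mem_powersetCard, Finset.subset_sdiff] at hs ht
    rw [← Finset.union_sdiff_cancel_left hs.1.2.symm, hst,
      Finset.union_sdiff_cancel_left ht.1.2.symm]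
  · intro s hs
    rw [mem_slice] at hs
    refine ⟨s \ C, ?_, Finset.union_sdiff_of_subset hs.1⟩
    rw [Finset.mem_powersetCard, Finset.card_sdiff_of_subset hs.1, hs.2.2]
    exact ⟨Finset.sdiff_subset_sdiff hs.2.1 subset_rfl, rfl⟩

theorem le_choose_of_lt {m j : ℕ} (hj : 0 < j) (hjm : j < m) : m ≤ m.choose j := by
  induction m with
  | zero => omega
  | succ m ih =>
    obtain ⟨j, rfl⟩ := Nat.exists_eq_add_one.2 hj
    rw [Nat.choose_succ_succ']
    rcases Nat.lt_or_ge (j + 1) m with h | h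
    · have := ih h
      have := Nat.choose_pos (n := m) (k := j) (by omega)
      omega
    · obtain rfl : m = j + 1 := by omega
      simp

theorem le_card_slice (hCD : C ⊆ D) (hk : C.card < k) (hk' : k < D.card) :
    D.card - C.card ≤ (slice C D k).card := by
  rw [card_slice hCD hk.le]
  exact le_choose_of_lt (by omega) (by omega)

/-- For `i ∈ t \ s`, the set `s` extends to size `b` inside `D` without using `i`, because `b <
D.card`. -/
theorem slice_ne_up (hst : s ≠ t) (hs : s ∈ slice C D a) (ht : t ∈ slice C D a) (hab : a ≤ b)
    (hb : b < D.card) : slice s D b ≠ slice t D b := by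
  rw [mem_slice] at hs ht
  obtain ⟨i, hit, his⟩ : ∃ i ∈ t, i ∉ s := by
    by_contra! h
    exact hst (Finset.eq_of_subset_of_card_le h (by omega)).symm
  have hiD := ht.2.1 hit
  obtain ⟨r, hsr, hrD, hr⟩ := Finset.exists_subsuperset_card_eq (n := b)
    (Finset.subset_erase.2 ⟨hs.2.1, his⟩) (by omega)
    (by rw [Finset.card_erase_of_mem hiD]; omega)
  intro h
  have hr' : r ∈ slice s D b := mem_slice.2 ⟨hsr, hrD.trans (Finset.erase_subset _ _), hr⟩
  rw [h, mem_slice] at hr'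
  exact Finset.notMem_erase i D (hrD (hr'.1 hit))

/-- Dually, for `i ∈ s \ t`, some `a`-subset of `s` above `C` contains `i`, because `C.card < a`. -/
theorem slice_ne_down (hst : s ≠ t) (hs : s ∈ slice C D b) (ht : t ∈ slice C D b) (hab : a ≤ b)
    (ha : C.card < a) : slice C s a ≠ slice C t a := by
  rw [mem_slice] at hs ht
  obtain ⟨i, his, hit⟩ : ∃ i ∈ s, i ∉ t := by
    by_contra! h
    exact hst (Finset.eq_of_subset_of_card_le h (by omega))
  obtain ⟨r, hCr, hrs, hr⟩ := Finset.exists_subsuperset_card_eq (n := a)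
    (Finset.insert_subset his hs.1)
    (by rw [Finset.card_insert_of_notMem fun h => hit (ht.1 h)]; omega) (by omega)
  intro h
  have hr' : r ∈ slice C s a := mem_slice.2 ⟨(Finset.subset_insert _ _).trans hCr, hrs, hr⟩
  rw [h, mem_slice] at hr'
  exact hit (hr'.2.1 (hCr (Finset.mem_insert_self _ _)))

theorem exists_mem_ne_mem {β : Type*} {s t : Finset β} (hs : 0 < s.card) (ht : 1 < t.card) :
    ∃ a ∈ s, ∃ b ∈ t, a ≠ b := by
  obtain ⟨a, ha⟩ := Finset.card_pos.1 hs
  obtain ⟨b, hb, hba⟩ := Finset.exists_mem_ne ht a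
  exact ⟨a, ha, b, hb, hba.symm⟩

theorem exists_pair_avoiding {β : Type*} [DecidableEq β] {s : Finset β} (hs : 4 ≤ s.card)
    (v y : β) : ∃ a ∈ s, ∃ b ∈ s, a ≠ b ∧ a ≠ v ∧ a ≠ y ∧ b ≠ v ∧ b ≠ y := by
  have h1 := Finset.le_card_sdiff {v, y} s
  have h2 := Finset.card_le_two (a := v) (b := y)
  obtain ⟨a, ha, b, hb, hab⟩ := Finset.one_lt_card.1 (show 1 < (s \ {v, y}).card by omega)
  simp only [Finset.mem_sdiff, Finset.mem_insert, Finset.mem_singleton, not_or] at ha hb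
  exact ⟨a, ha.1, b, hb.1, hab, ha.2.1, ha.2.2, hb.2.1, hb.2.2⟩

/-- Two distinct sets with at least three elements each have distinct representatives outside
a given pair. -/
theorem exists_distinct_representatives {β : Type*} [DecidableEq β] {s t : Finset β}
    (hst : s ≠ t) (hs : 3 ≤ s.card) (ht : 3 ≤ t.card) (v y : β) :
    ∃ a ∈ s, ∃ b ∈ t, a ≠ b ∧ a ≠ v ∧ a ≠ y ∧ b ≠ v ∧ b ≠ y := by
  have out : ∀ r : Finset β, 3 ≤ r.card → ∃ a ∈ r, a ≠ v ∧ a ≠ y := by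
    intro r hr
    have h1 := Finset.le_card_sdiff {v, y} r
    have h2 := Finset.card_le_two (a := v) (b := y)
    obtain ⟨a, ha⟩ := Finset.card_pos.1 (show 0 < (r \ {v, y}).card by omega)
    simp only [Finset.mem_sdiff, Finset.mem_insert, Finset.mem_singleton, not_or] at ha
    exact ⟨a, ha⟩
  obtain ⟨a, ha, hav, hay⟩ := out s hs
  obtain ⟨b, hb, hbv, hby⟩ := out t ht
  by_contra! h
  -- Failure means that outside `{v, y}` both sets reduce to the same single element. Both are then
  -- the three-element set `{a, v, y}`, contradicting `s ≠ t`.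
  have key : ∀ c ∈ s, ∀ d ∈ t, c ≠ v → c ≠ y → d ≠ v → d ≠ y → c = d := by
    intro c hc d hd h1 h2 h3 h4
    by_contra hcd
    exact h4 (h c hc d hd hcd h1 h2 h3)
  have h3 := Finset.card_le_three (a := a) (b := v) (c := y)
  have hs' : s ⊆ {a, v, y} := fun c hc => by
    simp only [Finset.mem_insert, Finset.mem_singleton]
    by_contra! hc'
    exact hc'.1 ((key c hc b hb hc'.2.1 hc'.2.2 hbv hby).trans
      (key a ha b hb hav hay hbv hby).symm)
  have ht' : t ⊆ {a, v, y} := fun c hc => by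
    simp only [Finset.mem_insert, Finset.mem_singleton]
    by_contra! hc'
    exact hc'.1 (key a ha c hc hav hay hc'.2.1 hc'.2.2).symm
  exact hst ((Finset.eq_of_subset_of_card_le hs' (by omega)).trans
    (Finset.eq_of_subset_of_card_le ht' (by omega)).symm)

theorem exists_two_up (hb : b < D.card) (hab : a < b) (hs : s ∈ slice C D a)
    (ht : t ∈ slice C D a) : ∃ s' ∈ slice s D b, ∃ t' ∈ slice t D b, s' ≠ t' := by
  rw [mem_slice] at hs ht
  have h1 := le_card_slice (k := b) hs.2.1 (by omega) hb
  have h2 := le_card_slice (k := b) ht.2.1 (by omega) hb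
  exact exists_mem_ne_mem (by omega) (by omega)

theorem exists_two_down (ha : C.card < a) (hab : a < b) (hs : s ∈ slice C D b)
    (ht : t ∈ slice C D b) : ∃ s' ∈ slice C s a, ∃ t' ∈ slice C t a, s' ≠ t' := by
  rw [mem_slice] at hs ht
  have h1 := le_card_slice (k := a) hs.1 ha (by omega)
  have h2 := le_card_slice (k := a) ht.1 ha (by omega)
  exact exists_mem_ne_mem (by omega) (by omega)

/-- Two disjoint pairs `z ⊆ z'`, `w ⊆ w'` between two levels, avoiding given pairs of sets. -/
theorem exists_cross_matching (hCD : C ⊆ D) (h4 : C.card + 4 ≤ D.card) (ha : C.card < a)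
    (hab : a < b) (hb : b < D.card) (u x v y : Finset α) :
    ∃ z ∈ slice C D a, ∃ w ∈ slice C D a, ∃ z' ∈ slice C D b, ∃ w' ∈ slice C D b,
      z ≠ w ∧ z' ≠ w' ∧ z ⊆ z' ∧ w ⊆ w' ∧ z ≠ u ∧ z ≠ x ∧ w ≠ u ∧ w ≠ x ∧
      z' ≠ v ∧ z' ≠ y ∧ w' ≠ v ∧ w' ≠ y := by
  -- Choose first on the side from which three continuations are guaranteed. An `a`-set has at least
  -- `D.card - a` supersets at level `b`; if this bound is below 3, then `b ≥ C.card + 3`, and a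
  -- `b`-set has at least `b - C.card ≥ 3` subsets at level `a`.
  by_cases h : a + 3 ≤ D.card
  · obtain ⟨z, hz, w, hw, hzw, h1, h2, h3, h4⟩ := exists_pair_avoiding
      (s := slice C D a) (by have := le_card_slice hCD ha (hab.trans hb); omega) u x
    have hne := slice_ne_up hzw hz hw hab.le hb
    have hz' := mem_slice.1 hz
    have hw' := mem_slice.1 hw
    obtain ⟨z', kz, w', kw, hzw', k⟩ := exists_distinct_representatives hne
      (by have := le_card_slice (k := b) hz'.2.1 (by omega) hb; omega)
      (by have := le_card_slice (k := b) hw'.2.1 (by omega) hb; omega) v y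
    rw [mem_slice] at kz kw
    exact ⟨z, hz, w, hw, z', mem_slice.2 ⟨hz'.1.trans kz.1, kz.2⟩, w',
      mem_slice.2 ⟨hw'.1.trans kw.1, kw.2⟩, hzw, hzw', kz.1, kw.1, h1, h2, h3, h4, k⟩
  · obtain ⟨z, hz, w, hw, hzw, k⟩ := exists_pair_avoiding
      (s := slice C D b) (by have := le_card_slice hCD (ha.trans hab) hb; omega) v y
    have hne := slice_ne_down hzw hz hw hab.le ha
    have hz' := mem_slice.1 hz
    have hw' := mem_slice.1 hw
    obtain ⟨z', kz, w', kw, hzw', h1, h2, h3, h4⟩ := exists_distinct_representatives hne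
      (by have := le_card_slice (k := a) hz'.1 ha (by omega); omega)
      (by have := le_card_slice (k := a) hw'.1 ha (by omega); omega) u x
    rw [mem_slice] at kz kw
    exact ⟨z', mem_slice.2 ⟨kz.1, kz.2.1.trans hz'.2.1, kz.2.2⟩, w',
      mem_slice.2 ⟨kw.1, kw.2.1.trans hw'.2.1, kw.2.2⟩, z, hz, w, hw, hzw', hzw,
      kz.2.1, kw.2.1, h1, h2, h3, h4, k⟩

end Slices

/-! ### Johnson graphs -/

section Johnson

variable {n : ℕ}

theorem johnsonAdj_of_le {u v : Finset (Fin n)} (huv : u ≠ v) (hc : u.card = v.card)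
    (h : u.card ≤ (u ∩ v).card + 1) : JohnsonAdj u v := by
  refine ⟨hc, le_antisymm ?_ h⟩
  refine Finset.card_lt_card (Finset.ssubset_iff_subset_ne.2 ⟨Finset.inter_subset_left, ?_⟩)
  intro h'
  exact huv (Finset.eq_of_subset_of_card_le (Finset.inter_eq_left.1 h') hc.ge)

/-- Johnson graphs on at least four points are paired 2-coverable. -/
theorem markedCoverable_slice {G : SimpleGraph (Finset (Fin n))}
    (hG : ∀ u v, JohnsonAdj u v → G.Adj u v) {C D : Finset (Fin n)} {k : ℕ} (hCD : C ⊆ D)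
    (h4 : C.card + 4 ≤ D.card) (hk : C.card < k) (hk' : k < D.card) :
    MarkedCoverable G (slice C D k : Set (Finset (Fin n))) (slice C D k) := by
  have clique : ∀ {C D : Finset (Fin n)}, k = C.card + 1 ∨ k + 1 = D.card →
      MarkedCoverable G (slice C D k : Set (Finset (Fin n))) (slice C D k) := by
    intro C D h
    refine MarkedCoverable.of_clique fun a ha b hb hab => hG _ _ ?_
    rw [mem_slice] at ha hb
    rcases h with h | h
    · have := Finset.card_le_card (Finset.subset_inter ha.1 hb.1)
      exact johnsonAdj_of_le hab (by omega) (by omega)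
    · have := Finset.card_le_card (Finset.union_subset ha.2.1 hb.2.1)
      have := Finset.card_inter_add_card_union a b
      exact johnsonAdj_of_le hab (by omega) (by omega)
  obtain ⟨m, hm⟩ : ∃ m, C.card + 4 + m = D.card := ⟨_, Nat.add_sub_cancel' h4⟩
  induction m generalizing C D with
  | zero =>
    by_cases hcl : k = C.card + 1 ∨ k + 1 = D.card
    · exact clique hcl
    · push Not at hcl
      obtain rfl : k = C.card + 2 := by omega
      refine MarkedCoverable.of_octahedron ?_ ?_
      · rw [card_slice hCD hk.le, ← hm, show C.card + 4 + 0 - C.card = 4 by omega,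
          show C.card + 2 - C.card = 2 by omega]
        rfl
      · intro a ha b hb c hc hab hac hbc
        rw [mem_slice] at ha hb hc
        -- In `J(4,2)` the only non-neighbour of a set is its complement relative to `C` and `D`,
        -- which is unique.
        have key : ∀ b, C ⊆ b → b ⊆ D → b.card = C.card + 2 → a ≠ b → ¬ G.Adj a b →
            a ∩ b = C ∧ a ∪ b = D := by
          intro b h1 h2 h3 h4 h5
          have h6 : ¬ a.card ≤ (a ∩ b).card + 1 := fun h =>
            h5 (hG _ _ (johnsonAdj_of_le h4 (by omega) h))
          have h7 := Finset.card_inter_add_card_union a b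
          exact ⟨(Finset.eq_of_subset_of_card_le (Finset.subset_inter ha.1 h1) (by omega)).symm,
            Finset.eq_of_subset_of_card_le (Finset.union_subset ha.2.1 h2) (by omega)⟩
        by_contra! h
        obtain ⟨i1, i2⟩ := key b hb.1 hb.2.1 hb.2.2 hab h.1
        obtain ⟨j1, j2⟩ := key c hc.1 hc.2.1 hc.2.2 hac h.2
        rw [Finset.inter_comm] at i1 j1
        rw [Finset.union_comm] at i2 j2
        exact hbc (eq_of_inf_eq_sup_eq (a := a) (i1.trans j1.symm) (i2.trans j2.symm))
  | succ m ih =>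
    by_cases hcl : k = C.card + 1 ∨ k + 1 = D.card
    · exact clique hcl
    · push Not at hcl
      -- Split by membership of `e`. Since `C.card + 1 < k` and `k + 1 < D.card`, both halves are
      -- again nontrivial slices, with one free point fewer.
      obtain ⟨e, heD, heC⟩ : ∃ e ∈ D, e ∉ C := by
        by_contra! h
        have := Finset.card_le_card (show D ⊆ C from h)
        omega
      have hDe := Finset.card_erase_of_mem heD
      have hCe := Finset.card_insert_of_notMem heC
      have hC' : C ⊆ D.erase e := Finset.subset_erase.2 ⟨hCD, heC⟩
      have hC'' : insert e C ⊆ D := Finset.insert_subset heD hCD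
      have hV : (slice C D k : Set (Finset (Fin n))) =
          (slice C (D.erase e) k : Set (Finset (Fin n))) ∪ slice (insert e C) D k := by
        ext s
        simp only [Set.mem_union, Finset.mem_coe, mem_slice, Finset.subset_erase,
          Finset.insert_subset_iff]
        tauto
      -- Deleting `e` from the sets that contain it turns cross edges into inclusions between levels
      -- `k - 1` and `k` of the interval from `C` to `D.erase e`.
      have adj : ∀ z z', z ∈ slice C (D.erase e) (k - 1) → z' ∈ slice C (D.erase e) k → z ⊆ z' →
          insert e z ∈ slice (insert e C) D k ∧ G.Adj z' (insert e z) := by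
        intro z z' hz hz' hzz
        rw [mem_slice, Finset.subset_erase] at hz hz'
        have hc : (insert e z).card = k := by
          rw [Finset.card_insert_of_notMem hz.2.1.2]
          omega
        refine ⟨mem_slice.2 ⟨Finset.insert_subset_insert _ hz.1,
          Finset.insert_subset heD hz.2.1.1, hc⟩, hG _ _ (johnsonAdj_of_le ?_ ?_ ?_)⟩
        · intro h
          exact hz'.2.1.2 (h ▸ Finset.mem_insert_self e z)
        · omega
        · have := Finset.card_le_card (Finset.subset_inter hzz (Finset.subset_insert e z))
          omega
      have hinj : ∀ z w, z ∈ slice C (D.erase e) (k - 1) → w ∈ slice C (D.erase e) (k - 1) →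
          z ≠ w → insert e z ≠ insert e w := by
        intro z w hz hw hzw h
        rw [mem_slice, Finset.subset_erase] at hz hw
        exact hzw (by rw [← Finset.erase_insert hz.2.1.2, h, Finset.erase_insert hw.2.1.2])
      rw [hV]
      refine (MarkedCoverable.glue (X := slice C (D.erase e) k) ?_ subset_rfl
        (ih hC' (by omega) hk (by omega) (by omega))
        (ih hC'' (by omega) (by omega) hk' (by omega)) ?_ ?_ ?_).mono Set.subset_union_right
      · rw [Finset.disjoint_coe, Finset.disjoint_left]
        intro s hs hs'
        rw [mem_slice] at hs hs'
        exact Finset.notMem_erase e D (hs.2.1 (hs'.1 (Finset.mem_insert_self e C)))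
      · intro u x v y
        obtain ⟨z, hz, w, hw, z', hz', w', hw', hzw, hzw', hz1, hw1, n1, n2, n3, n4, n5⟩ :=
          exists_cross_matching (b := k) hC' (by omega) (show C.card < k - 1 by omega) (by omega)
            (by omega) (v.erase e) (y.erase e) u x
        have ne : ∀ r ∈ slice C (D.erase e) (k - 1), ∀ q, r ≠ q.erase e → insert e r ≠ q := by
          rintro r hr q hrq rfl
          rw [mem_slice, Finset.subset_erase] at hr
          exact hrq (Finset.erase_insert hr.2.1.2).symm
        obtain ⟨i1, i2⟩ := adj z z' hz hz' hz1
        obtain ⟨j1, j2⟩ := adj w w' hw hw' hw1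
        exact ⟨z', hz', w', hw', _, i1, _, j1, hzw', hinj z w hz hw hzw, i2, j2, n5.1, n5.2.1,
          n5.2.2.1, n5.2.2.2, ne z hz v n1, ne z hz y n2, ne w hw v n3, ne w hw y n4⟩
      · intro a ha b hb hab
        obtain ⟨z, hz, w, hw, hzw⟩ := exists_two_down (a := k - 1) (by omega) (by omega) ha hb
        rw [Finset.mem_coe] at ha hb
        have ha' := mem_slice.1 ha
        have hb' := mem_slice.1 hb
        have hz' := mem_slice.1 hz
        have hw' := mem_slice.1 hw
        have kz := mem_slice.2 ⟨hz'.1, hz'.2.1.trans ha'.2.1, hz'.2.2⟩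
        have kw := mem_slice.2 ⟨hw'.1, hw'.2.1.trans hb'.2.1, hw'.2.2⟩
        obtain ⟨i1, i2⟩ := adj z a kz ha hz'.2.1
        obtain ⟨j1, j2⟩ := adj w b kw hb hw'.2.1
        exact ⟨_, i1, _, j1, hinj z w kz kw hzw, i2, j2⟩
      · intro a ha b hb hab
        have low : ∀ a ∈ slice (insert e C) D k, a.erase e ∈ slice C (D.erase e) (k - 1) ∧
            insert e (a.erase e) = a := by
          intro a ha
          rw [mem_slice, Finset.insert_subset_iff] at ha
          refine ⟨mem_slice.2 ⟨Finset.subset_erase.2 ⟨ha.1.2, heC⟩,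
            Finset.erase_subset_erase _ ha.2.1, ?_⟩, Finset.insert_erase ha.1.1⟩
          rw [Finset.card_erase_of_mem ha.1.1, ha.2.2]
        obtain ⟨ka, ea⟩ := low a ha
        obtain ⟨kb, eb⟩ := low b hb
        obtain ⟨z, hz, w, hw, hzw⟩ := exists_two_up (b := k) (by omega) (by omega) ka kb
        have hz' := mem_slice.1 hz
        have hw' := mem_slice.1 hw
        have kz : z ∈ slice C (D.erase e) k :=
          mem_slice.2 ⟨(mem_slice.1 ka).1.trans hz'.1, hz'.2⟩
        have kw : w ∈ slice C (D.erase e) k :=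
          mem_slice.2 ⟨(mem_slice.1 kb).1.trans hw'.1, hw'.2⟩
        obtain ⟨-, i2⟩ := adj _ z ka kz hz'.1
        obtain ⟨-, j2⟩ := adj _ w kb kw hw'.1
        rw [ea] at i2
        rw [eb] at j2
        exact ⟨z, kz, w, kw, hzw, i2.symm, j2.symm⟩

end Johnson

/-! ### Stacking the levels -/

section Levels

/-- The graph on all subsets of an `n`-element set that induces `QJ n A` on the vertices of
`QJ n A`. -/
def ambientQJ (n : ℕ) (A : Finset ℕ) : SimpleGraph (Finset (Fin n)) where
  Adj u v :=
    JohnsonAdj u v ∨ (ConsecutiveIn A u.card v.card ∧ u ⊆ v) ∨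
      (ConsecutiveIn A v.card u.card ∧ v ⊆ u)
  symm := ⟨by
    rintro u v (⟨h1, h2⟩ | h | h)
    · exact Or.inl ⟨h1.symm, by rw [Finset.inter_comm, h2, h1]⟩
    · exact Or.inr (Or.inr h)
    · exact Or.inr (Or.inl h)⟩
  loopless := ⟨by
    rintro u (⟨_, h⟩ | ⟨h, _⟩ | ⟨h, _⟩)
    · simp at h
    · exact lt_irrefl _ h.2.2.1
    · exact lt_irrefl _ h.2.2.1⟩

variable {n : ℕ} {A : Finset ℕ}

theorem mem_slice_univ {k : ℕ} {s : Finset (Fin n)} :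
    s ∈ slice ∅ Finset.univ k ↔ s.card = k := by
  simp [mem_slice]

theorem exists_consecutive {b : ℕ} (hb : b ∈ A) :
    (∀ c ∈ A, b ≤ c) ∨ ∃ a, ConsecutiveIn A a b := by
  by_cases h : ({c ∈ A | c < b} : Finset ℕ).Nonempty
  · right
    obtain ⟨a, ha, hmax⟩ := Finset.exists_max_image _ id h
    simp only [Finset.mem_filter, id] at ha hmax
    refine ⟨a, ha.1, hb, ha.2, fun c hc hcab => ?_⟩
    have := hmax c ⟨hc, hcab.2⟩
    omega
  · left
    intro c hc
    by_contra! hcb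
    exact h ⟨c, Finset.mem_filter.2 ⟨hc, hcb⟩⟩

/-- The levels of `QJ n A` up to level `b < n` form a paired 2-coverable graph. -/
theorem markedCoverable_levels (hn : 4 ≤ n) (hA : ∀ a ∈ A, 0 < a) {b : ℕ} (hb : b ∈ A)
    (hbn : b < n) :
    MarkedCoverable (ambientQJ n A) {s | s.card ∈ A ∧ s.card ≤ b}
      (slice ∅ Finset.univ b : Finset (Finset (Fin n))) := by
  induction b using Nat.strong_induction_on with
  | _ b ih =>
    have hlevel : MarkedCoverable (ambientQJ n A)
        (slice ∅ Finset.univ b : Finset (Finset (Fin n)))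
        (slice ∅ Finset.univ b : Finset (Finset (Fin n))) :=
      markedCoverable_slice (fun _ _ => Or.inl) (Finset.empty_subset Finset.univ) (by simpa using hn)
        (by simpa using hA b hb) (by simpa using hbn)
    rcases exists_consecutive hb with hmin | ⟨a, hab⟩
    · convert hlevel using 1
      ext s
      rw [Finset.mem_coe, mem_slice_univ, Set.mem_ofPred_eq]
      constructor
      · exact fun h => le_antisymm h.2 (hmin _ h.1)
      · exact fun h => ⟨h ▸ hb, h.le⟩
    · have hlt := hab.2.2.1
      have hset : {s : Finset (Fin n) | s.card ∈ A ∧ s.card ≤ b} =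
          {s | s.card ∈ A ∧ s.card ≤ a} ∪
            ((slice ∅ Finset.univ b : Finset (Finset (Fin n))) : Set (Finset (Fin n))) := by
        ext s
        simp only [Set.mem_union, Finset.mem_coe, mem_slice_univ, Set.mem_ofPred_eq]
        constructor
        · intro h
          have := hab.2.2.2 _ h.1
          by_cases hs : s.card ≤ a
          · exact Or.inl ⟨h.1, hs⟩
          · right; omega
        · rintro (h | h)
          · exact ⟨h.1, by omega⟩
          · exact ⟨h ▸ hb, h.le⟩
      have ha0 : (∅ : Finset (Fin n)).card < a := by simpa using hA a hab.1
      have hbn' : b < (Finset.univ : Finset (Fin n)).card := by simpa using hbn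
      have adj : ∀ s t : Finset (Fin n), s.card = a → t.card = b → s ⊆ t →
          (ambientQJ n A).Adj s t := by
        rintro s t rfl rfl hst
        exact Or.inr (Or.inl ⟨hab, hst⟩)
      rw [hset]
      -- Here the mark `X` is level `a`, the only lower level joined to level `b`; the glued set is
      -- marked in level `b`.
      refine MarkedCoverable.glue ?_ ?_ (ih a hlt hab.1 (by omega)) hlevel ?_ ?_ ?_
      · rw [Set.disjoint_left]
        intro s hs hs'
        rw [Finset.mem_coe, mem_slice_univ] at hs'
        have := hs.2
        omega
      · intro s hs
        rw [Finset.mem_coe, mem_slice_univ] at hs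
        exact ⟨hs ▸ hab.1, hs.le⟩
      · intro u x v y
        obtain ⟨z, hz, w, hw, z', hz', w', hw', h1, h2, h3, h4, h⟩ :=
          exists_cross_matching (Finset.empty_subset _) (by simpa using hn) ha0 hlt hbn' u x v y
        refine ⟨z, hz, w, hw, z', hz', w', hw', h1, h2, ?_, ?_, h⟩
        · rw [mem_slice_univ] at hz hz'
          exact adj z z' hz hz' h3
        · rw [mem_slice_univ] at hw hw'
          exact adj w w' hw hw' h4
      · intro s hs t ht _
        obtain ⟨s', hs', t', ht', hne⟩ := exists_two_up hbn' hlt hs ht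
        rw [Finset.mem_coe, mem_slice_univ] at hs ht
        rw [mem_slice] at hs' ht'
        exact ⟨s', mem_slice_univ.2 hs'.2.2, t', mem_slice_univ.2 ht'.2.2, hne,
          adj s s' hs hs'.2.2 hs'.1, adj t t' ht ht'.2.2 ht'.1⟩
      · intro s hs t ht _
        obtain ⟨s', hs', t', ht', hne⟩ := exists_two_down ha0 hlt hs ht
        rw [Finset.mem_coe, mem_slice_univ] at hs ht
        rw [mem_slice] at hs' ht'
        exact ⟨s', ⟨hs'.2.2 ▸ hab.1, hs'.2.2.le⟩, t', ⟨ht'.2.2 ▸ hab.1, ht'.2.2.le⟩, hne,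
          (adj s' s hs'.2.2 hs hs'.2.1).symm, (adj t' t ht'.2.2 ht ht'.2.1).symm⟩

/-- The vertices of `QJ n A` form a paired 2-coverable set. -/
theorem markedCoverable_vertices (hn : 4 ≤ n) (hA : A.Nonempty) (hAn : A ⊆ Finset.Icc 1 n)
    (hA' : A ≠ {n}) :
    MarkedCoverable (ambientQJ n A) {s | s.card ∈ A} Set.univ := by
  have hpos : ∀ a ∈ A, 0 < a := fun a ha => (Finset.mem_Icc.1 (hAn ha)).1
  have hle : ∀ a ∈ A, a ≤ n := fun a ha => (Finset.mem_Icc.1 (hAn ha)).2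
  obtain ⟨b, hb, hmax⟩ := Finset.exists_max_image A id hA
  simp only [id] at hmax
  rcases (hle b hb).lt_or_eq with hbn | rfl
  · convert (markedCoverable_levels hn hpos hb hbn).mono (Set.subset_univ _) using 1
    ext s
    exact ⟨fun h => ⟨h, hmax _ h⟩, fun h => h.1⟩
  · obtain hmin | ⟨a, hab⟩ := exists_consecutive hb
    · exact absurd (Finset.eq_singleton_iff_unique_mem.2
        ⟨hb, fun c hc => le_antisymm (hle c hc) (hmin c hc)⟩) hA'
    · have hlt := hab.2.2.1
      have hset : {s : Finset (Fin b) | s.card ∈ A} =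
          insert Finset.univ {s | s.card ∈ A ∧ s.card ≤ a} := by
        ext s
        rw [Set.mem_insert_iff, ← Finset.card_eq_iff_eq_univ, Fintype.card_fin]
        simp only [Set.mem_ofPred_eq]
        constructor
        · intro h
          have := hab.2.2.2 _ h
          have := hle _ h
          by_cases hs : s.card ≤ a
          · exact Or.inr ⟨h, hs⟩
          · left; omega
        · rintro (h | h)
          · rwa [h]
          · exact h.1
      rw [hset]
      refine (markedCoverable_levels hn hpos hab.1 hlt).insert_apex ?_ ?_ ?_ ?_
      · simp [hlt]
      · intro s hs
        rw [Finset.mem_coe, mem_slice_univ] at hs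
        exact ⟨hs ▸ hab.1, hs.le⟩
      · intro s hs
        rw [Finset.mem_coe, mem_slice_univ] at hs
        refine Or.inr (Or.inl ⟨?_, Finset.subset_univ s⟩)
        rwa [hs, Finset.card_univ, Fintype.card_fin]
      · intro u v x
        have h4 := le_card_slice (k := a) (Finset.empty_subset (Finset.univ : Finset (Fin b)))
          (by simpa using hpos a hab.1) (by simpa using hlt)
        rw [Finset.card_univ, Fintype.card_fin, Finset.card_empty] at h4
        obtain ⟨z, hz, w, hw, hzw, h1, h2, h3, h5⟩ := exists_pair_avoiding (hn.trans h4) u v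
        by_cases hzx : z = x
        · exact ⟨w, hw, h3, h5, fun h => hzw (hzx.trans h.symm)⟩
        · exact ⟨z, hz, h1, h2, hzx⟩

/-- A path of the ambient graph whose vertices are vertices of `QJ n A` is a path of `QJ n A`. -/
theorem Spans.exists_walk_QJ {S : Set (Finset (Fin n))} (hS : ∀ s ∈ S, s.card ∈ A)
    {u v : QJVertex n A} (h : Spans (ambientQJ n A) u.1 v.1 S) :
    ∃ p : (QJ n A).Walk u v, p.IsPath ∧ ∀ w, w ∈ p.support ↔ w.1 ∈ S := by
  obtain ⟨p, hp, hpS⟩ := h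
  have aux : ∀ {u v : Finset (Fin n)} (p : (ambientQJ n A).Walk u v), p.IsPath →
      (∀ w ∈ p.support, w.card ∈ A) → ∀ (hu : u.card ∈ A) (hv : v.card ∈ A),
      ∃ q : (QJ n A).Walk ⟨u, hu⟩ ⟨v, hv⟩, q.IsPath ∧ ∀ w, w ∈ q.support ↔ w.1 ∈ p.support := by
    intro u v p hp hpA
    induction p with
    | nil => exact fun hu hv => ⟨.nil, by simp, by simp [Subtype.ext_iff]⟩
    | @cons c d e hcd p ih =>
      intro hu hv
      rw [SimpleGraph.Walk.cons_isPath_iff] at hp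
      obtain ⟨q, hq, hqS⟩ := ih hp.1 (fun w hw => hpA w (by simp [hw])) (hpA d (by simp)) hv
      refine ⟨.cons (show (QJ n A).Adj ⟨c, hu⟩ ⟨d, _⟩ from hcd) q, ?_, ?_⟩
      · rw [SimpleGraph.Walk.cons_isPath_iff, hqS]
        exact ⟨hq, hp.2⟩
      · simp [hqS, Subtype.ext_iff]
  obtain ⟨q, hq, hqS⟩ := aux p hp (fun w hw => hS w ((hpS w).1 hw)) u.2 v.2
  exact ⟨q, hq, fun w => (hqS w).trans (hpS w.1)⟩

end Levels

theorem theorem9 (n : ℕ) (A : Finset ℕ) (hn : 4 ≤ n) (hA : A.Nonempty)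
    (hAn : A ⊆ Finset.Icc 1 n) (hV : 4 ≤ Fintype.card (QJVertex n A)) :
    PairedTwoCoverable (QJ n A) := by
  -- This is the only role of the bound on the number of vertices: any other admissible `A` has a
  -- level strictly between `0` and `n`.
  have hA' : A ≠ {n} := by
    rintro rfl
    have : Fintype.card (QJVertex n {n}) ≤ 1 := by
      rw [Fintype.card_le_one_iff_subsingleton]
      refine ⟨fun s t => Subtype.ext ?_⟩
      have h : ∀ s : QJVertex n {n}, s.1 = Finset.univ := fun s =>
        Finset.card_eq_iff_eq_univ _ |>.1 (by simpa using s.2)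
      rw [h s, h t]
    omega
  intro u x v y hux hvy hd
  simp only [Set.disjoint_insert_left, Set.disjoint_singleton_left, Set.mem_insert_iff,
    Set.mem_singleton_iff, not_or] at hd
  obtain ⟨⟨huv, huy⟩, hxv, hxy⟩ := hd
  have inj : ∀ {s t : QJVertex n A}, s ≠ t → s.1 ≠ t.1 := fun h h' => h (Subtype.ext h')
  obtain ⟨S₁, S₂, hS, hSV, h1, h2⟩ :=
    (markedCoverable_vertices hn hA hAn hA' u.1 v.1 x.1 y.1 u.2 v.2 x.2 y.2 (inj huv) (inj hux)
      (inj huy) (inj (Ne.symm hxv)) (inj hvy) (inj hxy)).spans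
  have hmem : ∀ s, s ∈ S₁ ∪ S₂ ↔ s.card ∈ A := fun s => by rw [hSV]; rfl
  obtain ⟨p, hp, hpS⟩ := h1.exists_walk_QJ fun s hs => (hmem s).1 (Or.inl hs)
  obtain ⟨q, hq, hqS⟩ := h2.exists_walk_QJ fun s hs => (hmem s).1 (Or.inr hs)
  refine ⟨p, q, hp, hq, fun w hw hw' => ?_, fun w => ?_⟩
  · exact Set.disjoint_left.1 hS ((hpS w).1 hw) ((hqS w).1 hw')
  · rw [hpS, hqS]
    exact (hmem w.1).2 w.2
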